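/- **Lemma (bounded distortion of the absolutely continuous measure).** Let $\Delta=\{x\in\mathbb R^{d+1}: x_k\ge 0,\ \sum_k x_k=1\}$, with Lebesgue measure. A *simplex-splitting multidimensional continued fraction algorithm* (MCF) consists of a finite or countable family of pairwise disjoint open $d$-dimensional subsimplices $\Delta_i\subset\Delta$ ($i\in I$) covering almost all of $\Delta$, and of matrices $A_i\in GL(d+1,\mathbb Z)$ such that the inverses $A_i^{-1}$ have nonnegative entries, the map $f(x)=A_ix/\|A_ix\|_1$ ($x\in\Delta_i$) takes values in $\Delta$, and $f$ is Markov: $f(\Delta_i)\supset\Delta_j$ whenever $f(\Delta_i)\cap\Delta_j\neq\emptyset$. The Rauzy diagram has vertex set $I$ and an arrow $a\to b$ whenever $f(x)\in\Delta_b$ for some $x\in\Delta_a$. A path $\gamma=\gamma_1\to\cdots\to\gamma_n$ in it is *positive* if all entries of $A_{\gamma_1}^{-1}\cdots A_{\gamma_n}^{-1}$ are positive; $\Delta_\gamma$ denotes the subsimplex of the points $x$ with $f^{k-1}(x)\in\Delta_{\gamma_k}$ for $1\le k\le n$. The *special acceleration* associated with a positive path $\gamma$ is the first return map $Q$ of $f$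 to $\Delta_\gamma$. The set where it is defined is partitioned into the sets $\Delta^{(l)}$ of points with the same itinerary $l=(l_1,\dots,l_r)\in I^r$ under $f$ up to the first return time $r$; the words $l$ form the alphabet that codes $Q$, and $[a_1\cdots a_n]$ is the set of $x\in\Delta_\gamma$ with $Q^{k-1}(x)\in\Delta^{(a_k)}$ for $1\le k\le n$ (the cylinder of the empty word being $\Delta_\gamma$). Let $\mu$ be a probability measure on $\Delta_\gamma$, absolutely continuous with respect to Lebesgue measure, for which $Q$ is defined $\mu$-almost everywhere, and which is $Q$-invariant and ergodic. Then $\mu$ has the *bounded distortion property*: there is a constant $C>0$ such that for every nonempty cylinder $[a_1\cdots a_n]$ and every $1\le j\le n$, $$\frac1C\le\frac{\mu([a_1\cdots a_n])}{\mu([a_1\cdots a_j])\,\mu([a_{j+1}\cdots a_n])}\le C .$$ -/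

import Mathlib

open MeasureTheory
open scoped Matrix

namespace MCF

noncomputable section

/-- The radial projection `v ↦ v / ‖v‖₁`; on nonzero vectors with nonnegative coordinates it takes
values in the standard simplex. -/
def simplexNormalize {d : ℕ} (v : Fin (d + 1) → ℝ) : Fin (d + 1) → ℝ :=
  (∑ k, |v k|)⁻¹ • v

theorem measurable_simplexNormalize {d : ℕ} : Measurable (simplexNormalize (d := d)) := by
  unfold simplexNormalize
  fun_prop

/-- Lebesgue measure of the standard `d`-simplex `{x : x k ≥ 0, ∑ x k = 1}`, carried by the simplex
seen as a subset of `ℝ^(d+1)`: the measure of `E` is the volume of the cone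
`{t • x : x ∈ E, 0 < t ≤ 1}`. In the coordinates `v = t • x` one has `dv = t ^ d dt dx`, where `dx` is
Lebesgue measure in any `d` of the coordinates of `x`; so this is that measure divided by `d + 1`. -/
def lebesgue (d : ℕ) : Measure (Fin (d + 1) → ℝ) :=
  (volume.restrict {v : Fin (d + 1) → ℝ | (∀ k, 0 ≤ v k) ∧ ∑ k, v k ≤ 1}).map simplexNormalize

/-- The projective map `x ↦ A x / ‖A x‖₁` of an integer matrix `A`. -/
def projAct {d : ℕ} (A : Matrix (Fin (d + 1)) (Fin (d + 1)) ℤ) (x : Fin (d + 1) → ℝ) :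
    Fin (d + 1) → ℝ :=
  simplexNormalize (A.map (Int.cast : ℤ → ℝ) *ᵥ x)

/-- A (Markovian, linear) simplex-splitting multidimensional continued fraction algorithm with
alphabet `ι` on the standard `d`-simplex `Δ`. -/
structure SimplexSplitting (d : ℕ) (ι : Type*) where
  /-- The subsimplices into which `Δ` is split; `Δ_i` is the open simplex `(cell i).interior`. -/
  cell : ι → Affine.Simplex ℝ (Fin (d + 1) → ℝ) d
  /-- The matrix `A_i` with `f x = A_i x / ‖A_i x‖₁` on `Δ_i`. -/
  A : ι → GL (Fin (d + 1)) ℤ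
  /-- The vertices of the subsimplices lie in `Δ`. -/
  vertex_mem : ∀ i k, (cell i).points k ∈ stdSimplex ℝ (Fin (d + 1))
  /-- The subsimplices do not overlap. -/
  disjoint : ∀ i j, i ≠ j → Disjoint (cell i).interior (cell j).interior
  /-- The subsimplices cover almost all of `Δ`. -/
  cover : ∀ᵐ x ∂(lebesgue d), ∃ i, x ∈ (cell i).interior
  /-- `f` takes values in `Δ`. -/
  mapsTo : ∀ i, ∀ x ∈ (cell i).interior,
    projAct (A i : Matrix (Fin (d + 1)) (Fin (d + 1)) ℤ) x ∈ stdSimplex ℝ (Fin (d + 1))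
  /-- The quotient matrices `A_i⁻¹` are nonnegative. -/
  quotient_nonneg : ∀ i k l,
    0 ≤ (((A i)⁻¹ : GL (Fin (d + 1)) ℤ) : Matrix (Fin (d + 1)) (Fin (d + 1)) ℤ) k l
  /-- Markov property: `f Δ_i` contains each `Δ_j` that it meets. -/
  markov : ∀ i j,
    ((projAct (A i : Matrix (Fin (d + 1)) (Fin (d + 1)) ℤ) '' (cell i).interior) ∩
      (cell j).interior).Nonempty →
    (cell j).interior ⊆ projAct (A i : Matrix (Fin (d + 1)) (Fin (d + 1)) ℤ) '' (cell i).interior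

/-- The cylinder `[w_1 ⋯ w_n]` of a map `Q` on `X` with pieces `P l` (`l ∈ L`): the points of `X` with
`Q^[k] x ∈ P w_{k+1}` for `k < n`. The empty word gives `X`. -/
def wordCylinder {α L : Type*} (X : Set α) (Q : α → α) (P : L → Set α) (w : List L) : Set α :=
  {x ∈ X | ∀ (k : ℕ) (hk : k < w.length), Q^[k] x ∈ P w[k]}

/-- The bounded distortion property of the measure `μ` for the map `Q` on `X`, coded by the
pieces `P l`. -/
def BoundedDistortion {α L : Type*} [MeasurableSpace α] (X : Set α) (Q : α → α) (P : L → Set α)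
    (μ : Measure α) : Prop :=
  ∃ C : ℝ, 0 < C ∧ ∀ w : List L, (wordCylinder X Q P w).Nonempty → ∀ j : ℕ, 1 ≤ j → j ≤ w.length →
    1 / C ≤ μ.real (wordCylinder X Q P w) /
      (μ.real (wordCylinder X Q P (w.take j)) * μ.real (wordCylinder X Q P (w.drop j))) ∧
    μ.real (wordCylinder X Q P w) /
      (μ.real (wordCylinder X Q P (w.take j)) * μ.real (wordCylinder X Q P (w.drop j))) ≤ C

namespace SimplexSplitting

variable {d : ℕ} {ι : Type*} (T : SimplexSplitting d ι)

/-- The open subsimplex `Δ_i`. -/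
def piece (i : ι) : Set (Fin (d + 1) → ℝ) := (T.cell i).interior

open Classical in
/-- The map `f x = A_i x / ‖A_i x‖₁` for `x ∈ Δ_i` (and, by convention, the identity on the null set
outside the subsimplices). -/
def f (x : Fin (d + 1) → ℝ) : Fin (d + 1) → ℝ :=
  if h : ∃ i, x ∈ T.piece i then
    projAct (T.A h.choose : Matrix (Fin (d + 1)) (Fin (d + 1)) ℤ) x
  else x

/-- The arrows of the Rauzy diagram. -/
def Arrow (a b : ι) : Prop := ∃ x ∈ T.piece a, T.f x ∈ T.piece b

/-- A path of the Rauzy diagram, given by its nonempty sequence of vertices. -/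
def IsPath (γ : List ι) : Prop := γ ≠ [] ∧ γ.IsChain T.Arrow

/-- The matrix of the cocycle along a path `γ_1 → ⋯ → γ_n`: the product
`A_{γ_1}⁻¹ ⋯ A_{γ_n}⁻¹` of the quotient matrices. -/
def pathMatrix (γ : List ι) : Matrix (Fin (d + 1)) (Fin (d + 1)) ℤ :=
  (((γ.map fun i => (T.A i)⁻¹).prod : GL (Fin (d + 1)) ℤ) :
    Matrix (Fin (d + 1)) (Fin (d + 1)) ℤ)

/-- A positive path. -/
def IsPositivePath (γ : List ι) : Prop := T.IsPath γ ∧ ∀ k l, 0 < T.pathMatrix γ k l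

/-- The subsimplex `Δ_γ` of the points whose itinerary starts with `γ`. -/
def subsimplex (γ : List ι) : Set (Fin (d + 1) → ℝ) :=
  wordCylinder (stdSimplex ℝ (Fin (d + 1))) T.f T.piece γ

/-- The positive times at which the orbit of `x` is in `Δ_γ`. -/
def returnTimes (γ : List ι) (x : Fin (d + 1) → ℝ) : Set ℕ :=
  {n | 0 < n ∧ T.f^[n] x ∈ T.subsimplex γ}

/-- The first return time to `Δ_γ` (meaningful when `returnTimes` is nonempty). -/
def returnTime (γ : List ι) (x : Fin (d + 1) → ℝ) : ℕ := sInf (T.returnTimes γ x)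

/-- The special acceleration: the first return map to `Δ_γ`. -/
def acceleration (γ : List ι) (x : Fin (d + 1) → ℝ) : Fin (d + 1) → ℝ :=
  T.f^[T.returnTime γ x] x

/-- The pieces `Δ^(u)` of the special acceleration, labelled by words `u` in the alphabet `ι`: the
points of `Δ_γ` that return to `Δ_γ` and whose itinerary up to the first return is `u`. (It is empty
unless `u` is the itinerary of a first return.) -/
def accelerationPiece (γ : List ι) (u : List ι) : Set (Fin (d + 1) → ℝ) :=
  {x ∈ T.subsimplex γ | (T.returnTimes γ x).Nonempty ∧ T.returnTime γ x = u.length ∧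
    x ∈ T.subsimplex u}

/-- `μ` is an absolutely continuous ergodic invariant probability measure of the special
acceleration, the first return map to `Δ_γ` (which has to be defined `μ`-almost everywhere). -/
structure IsACErgodicMeasure (γ : List ι) (μ : Measure (Fin (d + 1) → ℝ)) : Prop where
  isProbabilityMeasure : IsProbabilityMeasure μ
  absolutelyContinuous : μ ≪ (lebesgue d).restrict (T.subsimplex γ)
  ae_return : ∀ᵐ x ∂μ, (T.returnTimes γ x).Nonempty
  ergodic : Ergodic (T.acceleration γ) μ

end SimplexSplitting

end

end MCF

/-! The proof joins a geometric fact about Lebesgue measure to a measure-theoretic one about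
invariant measures.

Geometry: by the Markov property `Q` maps each nonempty piece onto all of Δ_γ
(`inverse_branch_acceleration`). So a cylinder [wv] with [w] nonempty is the image of [v] under one
projective map with nonnegative unimodular matrix (`accelerationCylinder_append`). Positivity of γ
keeps Δ_γ away from the boundary of the simplex: all coordinates are at least some κ > 0. On such a
set the projective map multiplies Lebesgue measure by a constant up to a factor κ^{-(d+1)}, which
does not depend on the matrix (`exists_lebesgue_image_projAct_bounds`). Taking v empty identifies
that constant with the measure of [w]. Hence Lebesgue measure ρ on Δ_γ is quasi-Bernoulli: ρ[wv] ≍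
ρ[w] ρ[v] (`exists_lebesgue_quasiBernoulli`).

Measure theory: an invariant probability μ ≪ ρ is comparable with ρ on cylinders
(`measure_symbolCylinder_comparable`). Let h be the density and g_n its conditional expectation
given the first n + 1 letters. By invariance μ[v] is the sum of μ[wv] over words w of length n + 1.
Up to ‖g_n - h‖₁ this is ∑ g_n(w) ρ[wv], which is comparable with ρ[v] ∑ g_n(w) ρ[w], and the last
sum tends to 1. No bound on h is needed beforehand: convergence in L¹ suffices. The quasi-Bernoulli
property then passes from ρ to μ. -/

namespace MCF

/-! ### Quasi-Bernoulli measures on sequence space -/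

section Symbolic

open Filter
open scoped ENNReal Topology

variable {L : Type*}

/-- The cylinder of the sequences that start with the word `w`; the symbol `none` stands for an
undefined letter. -/
def symbolCylinder (w : List L) : Set (ℕ → Option L) :=
  {s | ∀ k < w.length, s k = w[k]?}

/-- The `m`-th power of the shift. -/
def shift (m : ℕ) (s : ℕ → Option L) : ℕ → Option L := fun k => s (k + m)

theorem symbolCylinder_append (w v : List L) :
    symbolCylinder (w ++ v) = symbolCylinder w ∩ shift w.length ⁻¹' symbolCylinder v := by
  ext s
  simp only [symbolCylinder, shift, Set.mem_inter_iff, Set.mem_preimage, Set.mem_ofPred_eq,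
    List.length_append]
  constructor
  · refine fun h => ⟨fun k hk => ?_, fun k hk => ?_⟩
    · rw [h k (by omega), List.getElem?_append_left hk]
    · rw [h _ (by omega), List.getElem?_append_right (by omega), Nat.add_sub_cancel]
  · rintro ⟨h₁, h₂⟩ k hk
    rcases lt_or_ge k w.length with hkw | hkw
    · rw [h₁ k hkw, List.getElem?_append_left hkw]
    · have := h₂ (k - w.length) (by omega)
      rwa [Nat.sub_add_cancel hkw, ← List.getElem?_append_right hkw] at this

theorem disjoint_symbolCylinder {w v : List L} (hlen : w.length = v.length) (hne : w ≠ v) :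
    Disjoint (symbolCylinder w) (symbolCylinder v) := by
  rw [Set.disjoint_left]
  intro s hw hv
  refine hne (List.ext_getElem? fun k => ?_)
  rcases lt_or_ge k w.length with hk | hk
  · rw [← hw k hk, hv k (hlen ▸ hk)]
  · rw [List.getElem?_eq_none hk, List.getElem?_eq_none (hlen ▸ hk)]

theorem exists_mem_symbolCylinder (n : ℕ) {s : ℕ → Option L} (hs : ∀ k, s k ≠ none) :
    ∃ w : List L, w.length = n ∧ s ∈ symbolCylinder w := by
  choose t ht using fun k => Option.ne_none_iff_exists'.1 (hs k)
  refine ⟨List.ofFn fun i : Fin n => t i, by simp, fun k hk => ?_⟩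
  have hk' : k < n := by simpa using hk
  simp [ht, hk']

variable [MeasurableSpace (Option L)]

theorem measurable_shift (m : ℕ) : Measurable (shift (L := L) m) :=
  measurable_pi_lambda _ fun k => measurable_pi_apply (k + m)

/-- A function that depends on the first `n + 1` letters is constant on the cylinders of length
`n + 1`. -/
theorem setLIntegral_of_dependsOn {ρ : Measure (ℕ → Option L)} {n : ℕ}
    {g : (ℕ → Option L) → ℝ} (hg : DependsOn g (Set.Iic n)) {w : List L} (hw : w.length = n + 1)
    {E : Set (ℕ → Option L)} (hE : MeasurableSet E) (hEw : E ⊆ symbolCylinder w) :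
    ∫⁻ s in E, ENNReal.ofReal (g s) ∂ρ = ENNReal.ofReal (g fun k => w[k]?) * ρ E := by
  rw [← setLIntegral_const]
  refine setLIntegral_congr_fun hE fun s hs => congrArg ENNReal.ofReal ?_
  refine hg fun k hk => hEw hs k ?_
  have := Set.mem_Iic.1 hk
  omega

variable [MeasurableSingletonClass (Option L)]

theorem measurableSet_symbolCylinder (w : List L) : MeasurableSet (symbolCylinder w) := by
  have : symbolCylinder w = ⋂ k, ⋂ (_ : k < w.length), (fun s : ℕ → Option L => s k) ⁻¹' {w[k]?} := by
    ext s; simp [symbolCylinder]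
  rw [this]
  exact MeasurableSet.iInter fun k => MeasurableSet.iInter fun _ =>
    measurable_pi_apply k (measurableSet_singleton _)

/-- A shift invariant probability measure that is absolutely continuous with respect to a measure
`ρ` with the quasi-Bernoulli property is comparable with `ρ` on cylinders. -/
theorem measure_symbolCylinder_comparable {ν ρ : Measure (ℕ → Option L)} [IsProbabilityMeasure ν]
    [IsFiniteMeasure ρ] [Countable L] (hac : ν ≪ ρ) (hshift : ∀ m, ν.map (shift m) = ν)
    (hsome : ∀ᵐ s ∂ν, ∀ k, s k ≠ none) {K : ℝ≥0∞} (hK : K ≠ ∞)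
    (hup : ∀ w v : List L, ρ (symbolCylinder (w ++ v)) ≤
      K * (ρ (symbolCylinder w) * ρ (symbolCylinder v)))
    (hlow : ∀ w v : List L, ρ (symbolCylinder w) * ρ (symbolCylinder v) ≤
      K * ρ (symbolCylinder (w ++ v))) (v : List L) :
    ν (symbolCylinder v) ≤ K * ρ (symbolCylinder v) ∧
      ρ (symbolCylinder v) ≤ K * ν (symbolCylinder v) := by
  set h : (ℕ → Option L) → ℝ := fun s => (ν.rnDeriv ρ s).toReal with hh
  have hint : Integrable h ρ := Measure.integrable_toReal_rnDeriv
  have hmeas : Measurable h := (Measure.measurable_rnDeriv ν ρ).ennreal_toReal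
  have hνE : ∀ E : Set (ℕ → Option L), ∫⁻ s in E, ENNReal.ofReal (h s) ∂ρ = ν E := by
    intro E
    rw [← Measure.setLIntegral_rnDeriv hac E]
    refine lintegral_congr_ae (ae_restrict_of_ae ?_)
    filter_upwards [Measure.rnDeriv_lt_top ν ρ] with s hs
    exact ENNReal.ofReal_toReal hs.ne
  -- `ℱ n` is generated by the letters with indices 0, …, n, hence the word length n + 1 below. That
  -- these σ-algebras generate everything makes `g n` converge to h itself in L¹.
  set ℱ := Filtration.piLE (X := fun _ : ℕ => Option L) with hℱ
  have hsup : (⨆ n, ℱ n) = MeasurableSpace.pi := by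
    refine le_antisymm (iSup_le fun n => ℱ.le n) (iSup_le fun k => ?_)
    refine le_trans ?_ (le_iSup (fun n => ℱ n) k)
    rintro _ ⟨t, ht, rfl⟩
    exact ⟨(fun r : (∀ _ : Set.Iic k, Option L) => r ⟨k, Set.mem_Iic.2 le_rfl⟩) ⁻¹' t,
      measurable_pi_apply _ ht, rfl⟩
  set g : ℕ → (ℕ → Option L) → ℝ := fun n => ρ[h | ℱ n] with hg
  set ε : ℕ → ℝ≥0∞ := fun n => eLpNorm (g n - h) 1 ρ with hε
  have hlim : Tendsto ε atTop (𝓝 0) :=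
    hint.tendsto_eLpNorm_condExp (by rw [hsup]; exact hmeas.stronglyMeasurable)
  have hgdep : ∀ n, DependsOn (g n) (Set.Iic n) := fun n =>
    stronglyMeasurable_condExp.dependsOn_of_piLE
  have hgm : ∀ n, Measurable (g n) := fun n =>
    (stronglyMeasurable_condExp.mono (ℱ.le n)).measurable
  have hε' : ∀ n, ε n = ∫⁻ s, ENNReal.ofReal |g n s - h s| ∂ρ := by
    intro n
    simp [hε, eLpNorm_one_eq_lintegral_enorm, Real.enorm_eq_ofReal_abs]
  -- Positive parts are compared, so the sign of `g n` never has to be discussed.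
  have hle : ∀ (a b : ℝ), ENNReal.ofReal a ≤ ENNReal.ofReal b + ENNReal.ofReal |b - a| := by
    intro a b
    refine le_trans (ENNReal.ofReal_le_ofReal ?_) ENNReal.ofReal_add_le
    linarith [neg_abs_le (b - a)]
  have hgh : ∀ n E, ν E ≤ ∫⁻ s in E, ENNReal.ofReal (g n s) ∂ρ + ε n := by
    intro n E
    rw [← hνE E, hε' n]
    refine (lintegral_mono fun s => hle (h s) (g n s)).trans ?_
    rw [lintegral_add_left (hgm n).ennreal_ofReal]
    exact add_le_add le_rfl (setLIntegral_le_lintegral _ _)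
  have hhg : ∀ n E, ∫⁻ s in E, ENNReal.ofReal (g n s) ∂ρ ≤ ν E + ε n := by
    intro n E
    rw [← hνE E, hε' n]
    refine (lintegral_mono fun s => hle (g n s) (h s)).trans ?_
    rw [lintegral_add_left hmeas.ennreal_ofReal]
    simp only [fun s => abs_sub_comm (h s) (g n s)]
    exact add_le_add le_rfl (setLIntegral_le_lintegral _ _)
  -- `D n v` is, up to a ν-null set, the preimage of the cylinder of v under the shift by n + 1.
  -- Invariance gives it the ν-measure of that cylinder, while `g n` is constant on each set of the
  -- union.
  set D : ℕ → List L → Set (ℕ → Option L) := fun n v =>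
    ⋃ w : {w : List L // w.length = n + 1}, symbolCylinder (w.1 ++ v) with hD
  have hDint : ∀ n v, ∫⁻ s in D n v, ENNReal.ofReal (g n s) ∂ρ =
      ∑' w : {w : List L // w.length = n + 1},
        ENNReal.ofReal (g n fun k => w.1[k]?) * ρ (symbolCylinder (w.1 ++ v)) := by
    intro n v
    rw [lintegral_iUnion (fun w => measurableSet_symbolCylinder _)]
    · refine tsum_congr fun w => setLIntegral_of_dependsOn (hgdep n) w.2
        (measurableSet_symbolCylinder _) ?_
      rw [symbolCylinder_append]
      exact Set.inter_subset_left
    · intro w w' hne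
      simp only [Function.onFun, symbolCylinder_append]
      exact (disjoint_symbolCylinder (w.2.trans w'.2.symm) fun h => hne (Subtype.ext h)).mono
        Set.inter_subset_left Set.inter_subset_left
  have hDν : ∀ n v, ν (D n v) = ν (symbolCylinder v) := by
    intro n v
    conv_rhs => rw [← hshift (n + 1),
      Measure.map_apply (measurable_shift _) (measurableSet_symbolCylinder v)]
    refine measure_congr ?_
    filter_upwards [hsome] with s hs
    refine propext ⟨fun hsD => ?_, fun hsv => ?_⟩
    · obtain ⟨w, hw⟩ := Set.mem_iUnion.1 hsD
      rw [symbolCylinder_append, w.2] at hw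
      exact hw.2
    · obtain ⟨w, hw, hsw⟩ := exists_mem_symbolCylinder (n + 1) hs
      refine Set.mem_iUnion.2 ⟨⟨w, hw⟩, ?_⟩
      rw [symbolCylinder_append]
      exact ⟨hsw, by rw [hw]; exact hsv⟩
  have hnil : symbolCylinder ([] : List L) = Set.univ := by ext; simp [symbolCylinder]
  have hD1 : ∀ n, ν (D n []) = 1 := fun n => by rw [hDν, hnil, measure_univ]
  -- Termwise, ρ[wv] ≤ K ρ[w] ρ[v] replaces the integral over `D n v` by one over `D n []`, a set of
  -- full ν-measure. Each passage between `g n` and h costs `ε n`.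
  have hu : ∀ n, ν (symbolCylinder v) ≤
      K * ρ (symbolCylinder v) * (1 + ε n) + ε n := by
    intro n
    calc ν (symbolCylinder v) ≤ ∫⁻ s in D n v, ENNReal.ofReal (g n s) ∂ρ + ε n := by
          rw [← hDν n v]; exact hgh n _
      _ ≤ K * ρ (symbolCylinder v) * ∫⁻ s in D n [], ENNReal.ofReal (g n s) ∂ρ + ε n := by
          gcongr
          rw [hDint, hDint, ← ENNReal.tsum_mul_left]
          refine ENNReal.tsum_le_tsum fun w => ?_
          rw [List.append_nil]
          calc _ ≤ ENNReal.ofReal (g n fun k => w.1[k]?) *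
                (K * (ρ (symbolCylinder w.1) * ρ (symbolCylinder v))) := by gcongr; exact hup _ _
            _ = _ := by ring
      _ ≤ _ := by gcongr; rw [← hD1 n]; exact hhg n _
  have hl : ∀ n, ρ (symbolCylinder v) ≤
      K * (ν (symbolCylinder v) + ε n) + ρ (symbolCylinder v) * ε n := by
    intro n
    calc ρ (symbolCylinder v) = ρ (symbolCylinder v) * ν (D n []) := by rw [hD1, mul_one]
      _ ≤ ρ (symbolCylinder v) * (∫⁻ s in D n [], ENNReal.ofReal (g n s) ∂ρ + ε n) := by
          gcongr; exact hgh n _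
      _ = ρ (symbolCylinder v) * ∫⁻ s in D n [], ENNReal.ofReal (g n s) ∂ρ +
          ρ (symbolCylinder v) * ε n := mul_add _ _ _
      _ ≤ K * ∫⁻ s in D n v, ENNReal.ofReal (g n s) ∂ρ + ρ (symbolCylinder v) * ε n := by
          refine add_le_add ?_ le_rfl
          rw [hDint, hDint, ← ENNReal.tsum_mul_left, ← ENNReal.tsum_mul_left]
          refine ENNReal.tsum_le_tsum fun w => ?_
          rw [List.append_nil]
          calc _ = ENNReal.ofReal (g n fun k => w.1[k]?) *
                (ρ (symbolCylinder w.1) * ρ (symbolCylinder v)) := by ring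
            _ ≤ ENNReal.ofReal (g n fun k => w.1[k]?) *
                (K * ρ (symbolCylinder (w.1 ++ v))) := mul_le_mul' le_rfl (hlow _ _)
            _ = _ := by ring
      _ ≤ _ := by gcongr; rw [← hDν n v]; exact hhg n _
  have hρ : ρ (symbolCylinder v) ≠ ∞ := measure_ne_top _ _
  have hν : ν (symbolCylinder v) ≠ ∞ := measure_ne_top _ _
  constructor
  · refine ge_of_tendsto' (x := atTop) (f := fun n => K * ρ (symbolCylinder v) * (1 + ε n) + ε n) ?_ hu
    have h1 : Tendsto (fun n => 1 + ε n) atTop (𝓝 (1 + 0)) := tendsto_const_nhds.add hlim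
    have h2 := (ENNReal.Tendsto.const_mul (a := K * ρ (symbolCylinder v)) h1
      (Or.inl (by simp))).add hlim
    simpa using h2
  · refine ge_of_tendsto'
      (x := atTop) (f := fun n => K * (ν (symbolCylinder v) + ε n) + ρ (symbolCylinder v) * ε n) ?_ hl
    have h1 : Tendsto (fun n => ν (symbolCylinder v) + ε n) atTop
      (𝓝 (ν (symbolCylinder v) + 0)) := tendsto_const_nhds.add hlim
    have h2 := (ENNReal.Tendsto.const_mul (a := K) h1 (Or.inr hK)).add
      (ENNReal.Tendsto.const_mul (a := ρ (symbolCylinder v)) hlim (Or.inr hρ))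
    simpa using h2

end Symbolic

/-! ### Transfer to a map through itineraries -/

section Coding

open scoped ENNReal

variable {α L : Type*} {X : Set α} {Q : α → α} {P : L → Set α}

theorem wordCylinder_nil : wordCylinder X Q P [] = X := by
  ext x; simp [wordCylinder]

theorem exists_code (hdisj : Pairwise (Function.onFun Disjoint P)) :
    ∃ c : α → Option L, ∀ x l, c x = some l ↔ x ∈ P l := by
  classical
  refine ⟨fun x => if h : ∃ l, x ∈ P l then some h.choose else none, fun x l => ?_⟩
  by_cases h : ∃ l, x ∈ P l
  · simp only [h, dite_true, Option.some.injEq]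
    refine ⟨fun e => e ▸ h.choose_spec, fun hl => ?_⟩
    by_contra hne
    exact Set.disjoint_left.1 (hdisj hne) h.choose_spec hl
  · simp only [h, dite_false, reduceCtorEq, false_iff]
    exact fun hl => h ⟨l, hl⟩

theorem wordCylinder_eq_inter_preimage {c : α → Option L} (hc : ∀ x l, c x = some l ↔ x ∈ P l)
    (w : List L) :
    wordCylinder X Q P w = X ∩ (fun x k => c (Q^[k] x)) ⁻¹' symbolCylinder w := by
  ext x
  simp only [wordCylinder, symbolCylinder, Set.mem_inter_iff, Set.mem_preimage, Set.mem_ofPred_eq]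
  refine and_congr_right fun _ => forall_congr' fun k => forall_congr' fun hk => ?_
  rw [List.getElem?_eq_getElem hk, hc]

/-- The itinerary map π intertwines Q with the shift. So the image of μ is shift invariant and
absolutely continuous with respect to the image of ρ, and cylinders correspond up to the condition
of lying in X, which holds almost everywhere. -/
theorem wordCylinder_comparable [MeasurableSpace α] [Countable L] {μ ρ : Measure α}
    [IsProbabilityMeasure μ] [IsFiniteMeasure ρ] (hac : μ ≪ ρ) (hX : ∀ᵐ x ∂ρ, x ∈ X)
    (hQ : MeasurePreserving Q μ μ) (hP : ∀ l, MeasurableSet (P l))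
    (hdisj : Pairwise (Function.onFun Disjoint P)) (hcover : ∀ᵐ x ∂μ, ∃ l, x ∈ P l)
    {K : ℝ≥0∞} (hK : K ≠ ∞)
    (hup : ∀ w v : List L, ρ (wordCylinder X Q P (w ++ v)) ≤
      K * (ρ (wordCylinder X Q P w) * ρ (wordCylinder X Q P v)))
    (hlow : ∀ w v : List L, ρ (wordCylinder X Q P w) * ρ (wordCylinder X Q P v) ≤
      K * ρ (wordCylinder X Q P (w ++ v))) (v : List L) :
    μ (wordCylinder X Q P v) ≤ K * ρ (wordCylinder X Q P v) ∧
      ρ (wordCylinder X Q P v) ≤ K * μ (wordCylinder X Q P v) := by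
  obtain ⟨c, hc⟩ := exists_code hdisj
  let _ : MeasurableSpace (Option L) := ⊤
  have hcm : Measurable c := by
    refine measurable_to_countable' fun o => ?_
    have hs : ∀ l, c ⁻¹' {some l} = P l := fun l => by ext x; simp [hc]
    rcases o with _ | l
    · have : c ⁻¹' {none} = (⋃ l, P l)ᶜ := by
        ext x
        simp [Option.eq_none_iff_forall_ne_some, hc]
      rw [this]
      exact (MeasurableSet.iUnion hP).compl
    · rw [hs]; exact hP l
  set π : α → ℕ → Option L := fun x k => c (Q^[k] x) with hπ
  have hπm : Measurable π :=
    measurable_pi_lambda _ fun k => hcm.comp (hQ.measurable.iterate k)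
  have key : ∀ m : Measure α, (∀ᵐ x ∂m, x ∈ X) → ∀ w : List L,
      m (wordCylinder X Q P w) = m.map π (symbolCylinder w) := by
    intro m hm w
    rw [Measure.map_apply hπm (measurableSet_symbolCylinder w), wordCylinder_eq_inter_preimage hc]
    exact measure_congr (by filter_upwards [hm] with x hx; exact propext (and_iff_right hx))
  have : IsProbabilityMeasure (μ.map π) := Measure.isProbabilityMeasure_map hπm.aemeasurable
  simp only [key ρ hX] at hup hlow
  rw [key μ (hac.ae_le hX), key ρ hX]
  refine measure_symbolCylinder_comparable (hac.map hπm) (fun m => ?_) ?_ hK hup hlow v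
  · rw [Measure.map_map (measurable_shift m) hπm]
    have : shift m ∘ π = π ∘ Q^[m] := by
      ext1 x
      funext k
      simp only [shift, hπ, Function.comp_apply, Function.iterate_add_apply]
    rw [this, ← Measure.map_map hπm (hQ.measurable.iterate m), (hQ.iterate m).map_eq]
  · have hms : MeasurableSet {s : ℕ → Option L | ∀ k, s k ≠ none} := by
      have : {s : ℕ → Option L | ∀ k, s k ≠ none} =
          ⋂ k, (fun s : ℕ → Option L => s k) ⁻¹' {none}ᶜ := by ext; simp
      rw [this]
      exact MeasurableSet.iInter fun k =>
        measurable_pi_apply k (measurableSet_singleton none).compl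
    rw [ae_map_iff hπm.aemeasurable hms, ae_all_iff]
    intro k
    filter_upwards [(hQ.iterate k).quasiMeasurePreserving.ae hcover] with x ⟨l, hl⟩
    simp [hπ, (hc _ _).2 hl]

/-- Comparing μ with ρ on each of the three cylinders costs one factor K, and the quasi-Bernoulli
inequality for ρ a fourth. -/
theorem boundedDistortion_of_quasiBernoulli [MeasurableSpace α] [Countable L] {μ ρ : Measure α}
    [IsProbabilityMeasure μ] [IsFiniteMeasure ρ] (hac : μ ≪ ρ) (hX : ∀ᵐ x ∂ρ, x ∈ X)
    (hQ : MeasurePreserving Q μ μ) (hP : ∀ l, MeasurableSet (P l))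
    (hdisj : Pairwise (Function.onFun Disjoint P)) (hcover : ∀ᵐ x ∂μ, ∃ l, x ∈ P l)
    {K : ℝ≥0∞} (hK : K ≠ ∞)
    (hup : ∀ w v : List L, ρ (wordCylinder X Q P (w ++ v)) ≤
      K * (ρ (wordCylinder X Q P w) * ρ (wordCylinder X Q P v)))
    (hlow : ∀ w v : List L, ρ (wordCylinder X Q P w) * ρ (wordCylinder X Q P v) ≤
      K * ρ (wordCylinder X Q P (w ++ v)))
    (hpos : ∀ w : List L, (wordCylinder X Q P w).Nonempty → ρ (wordCylinder X Q P w) ≠ 0) :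
    BoundedDistortion X Q P μ := by
  have hcomp := wordCylinder_comparable hac hX hQ hP hdisj hcover hK hup hlow
  set R : List L → Set α := wordCylinder X Q P with hR
  have hup' : ∀ w v, μ (R (w ++ v)) ≤ K ^ 4 * (μ (R w) * μ (R v)) := fun w v =>
    calc μ (R (w ++ v)) ≤ K * (K * ((K * μ (R w)) * (K * μ (R v)))) :=
          (hcomp _).1.trans (mul_le_mul' le_rfl ((hup w v).trans
            (mul_le_mul' le_rfl (mul_le_mul' (hcomp w).2 (hcomp v).2))))
      _ = _ := by ring
  have hlow' : ∀ w v, μ (R w) * μ (R v) ≤ K ^ 4 * μ (R (w ++ v)) := fun w v =>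
    calc μ (R w) * μ (R v) ≤ (K * ρ (R w)) * (K * ρ (R v)) :=
          mul_le_mul' (hcomp w).1 (hcomp v).1
      _ = K ^ 2 * (ρ (R w) * ρ (R v)) := by ring
      _ ≤ K ^ 2 * (K * (K * μ (R (w ++ v)))) :=
          mul_le_mul' le_rfl ((hlow w v).trans (mul_le_mul' le_rfl (hcomp _).2))
      _ = _ := by ring
  have hpos' : ∀ w, (R w).Nonempty → 0 < μ.real (R w) := by
    intro w hw
    refine ENNReal.toReal_pos (fun h0 => hpos w hw ?_) (measure_ne_top _ _)
    simpa [h0] using (hcomp w).2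
  have hK4 : K ^ 4 ≠ ∞ := ENNReal.pow_ne_top hK
  refine ⟨(K ^ 4).toReal + 1, by positivity, fun w hw j _ _ => ?_⟩
  have hw' := hw
  rw [← List.take_append_drop j w] at hw
  set a := w.take j
  set b := w.drop j
  have hab : a ++ b = w := List.take_append_drop j w
  have h0 : 0 < μ.real (R w) := hpos' w hw'
  have hu : μ.real (R w) ≤ (K ^ 4).toReal * (μ.real (R a) * μ.real (R b)) := by
    have := ENNReal.toReal_mono (by finiteness) (hup' a b)
    simpa [Measure.real, ENNReal.toReal_mul, hab] using this
  have hl : μ.real (R a) * μ.real (R b) ≤ (K ^ 4).toReal * μ.real (R w) := by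
    have := ENNReal.toReal_mono (by finiteness) (hlow' a b)
    simpa [Measure.real, ENNReal.toReal_mul, hab] using this
  -- Were the product zero, the upper bound would force the cylinder of w to be null.
  have hp : 0 < μ.real (R a) * μ.real (R b) := by
    have h1 : 0 ≤ μ.real (R a) * μ.real (R b) := by positivity
    rcases h1.eq_or_lt with h | h
    · rw [← h] at hu; linarith
    · exact h
  constructor
  · rw [le_div_iff₀ hp, one_div, inv_mul_le_iff₀ (by positivity)]
    nlinarith
  · rw [div_le_iff₀ hp]
    nlinarith

end Coding

/-! ### Projective maps and Lebesgue measure via cones -/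

section Projective

open scoped ENNReal Pointwise

variable {d : ℕ}

theorem simplexNormalize_smul {c : ℝ} (hc : 0 < c) (v : Fin (d + 1) → ℝ) :
    simplexNormalize (c • v) = simplexNormalize v := by
  simp only [simplexNormalize, Pi.smul_apply, smul_eq_mul, abs_mul, ← Finset.mul_sum, abs_of_pos hc,
    smul_smul]
  congr 1
  rw [mul_inv, mul_comm, ← mul_assoc, mul_inv_cancel₀ hc.ne', one_mul]

@[simp]
theorem simplexNormalize_zero : simplexNormalize (0 : Fin (d + 1) → ℝ) = 0 := by
  simp [simplexNormalize]

theorem simplexNormalize_of_nonneg {v : Fin (d + 1) → ℝ} (hv : ∀ k, 0 ≤ v k) :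
    simplexNormalize v = (∑ k, v k)⁻¹ • v := by
  simp only [simplexNormalize, abs_of_nonneg (hv _)]

theorem sum_smul_simplexNormalize {v : Fin (d + 1) → ℝ} (hv : ∀ k, 0 ≤ v k) :
    (∑ k, v k) • simplexNormalize v = v := by
  rw [simplexNormalize_of_nonneg hv, smul_smul]
  rcases eq_or_ne (∑ k, v k) 0 with h | h
  · have : v = 0 := by
      funext k
      exact (Finset.sum_eq_zero_iff_of_nonneg fun k _ => hv k).1 h k (Finset.mem_univ k)
    simp [this]
  · rw [mul_inv_cancel₀ h, one_smul]

theorem simplexNormalize_of_mem {x : Fin (d + 1) → ℝ} (hx : x ∈ stdSimplex ℝ (Fin (d + 1))) :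
    simplexNormalize x = x := by
  rw [simplexNormalize_of_nonneg hx.1, hx.2, inv_one, one_smul]

theorem projAct_simplexNormalize (M : Matrix (Fin (d + 1)) (Fin (d + 1)) ℤ)
    (v : Fin (d + 1) → ℝ) : projAct M (simplexNormalize v) = projAct M v := by
  rcases eq_or_ne v 0 with rfl | hv
  · simp
  · have hpos : 0 < ∑ k, |v k| := by
      obtain ⟨k, hk⟩ := Function.ne_iff.1 hv
      exact Finset.sum_pos' (fun _ _ => abs_nonneg _) ⟨k, Finset.mem_univ k, abs_pos.2 hk⟩
    rw [projAct, simplexNormalize.eq_1 v, Matrix.mulVec_smul, simplexNormalize_smul (inv_pos.2 hpos),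
      projAct]

theorem projAct_mul (M N : Matrix (Fin (d + 1)) (Fin (d + 1)) ℤ) (v : Fin (d + 1) → ℝ) :
    projAct (M * N) v = projAct M (projAct N v) := by
  rw [projAct.eq_1 N, projAct_simplexNormalize, projAct, projAct, Matrix.mulVec_mulVec]
  congr 2
  ext i j
  simp [Matrix.mul_apply]

theorem projAct_one {x : Fin (d + 1) → ℝ} (hx : x ∈ stdSimplex ℝ (Fin (d + 1))) :
    projAct 1 x = x := by
  rw [projAct, Matrix.map_one _ Int.cast_zero Int.cast_one, Matrix.one_mulVec,
    simplexNormalize_of_mem hx]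

theorem measurable_projAct (M : Matrix (Fin (d + 1)) (Fin (d + 1)) ℤ) :
    Measurable (projAct M) := by
  refine measurable_simplexNormalize.comp ?_
  exact (Continuous.matrix_mulVec continuous_const continuous_id).measurable

/-- The cone over `E` cut off at height `t`. -/
def truncatedCone (E : Set (Fin (d + 1) → ℝ)) (t : ℝ) : Set (Fin (d + 1) → ℝ) :=
  {v | (∀ k, 0 ≤ v k) ∧ ∑ k, v k ≤ t ∧ simplexNormalize v ∈ E}

theorem lebesgue_apply {E : Set (Fin (d + 1) → ℝ)} (hE : MeasurableSet E) :
    lebesgue d E = volume (truncatedCone E 1) := by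
  rw [lebesgue, Measure.map_apply measurable_simplexNormalize hE,
    Measure.restrict_apply (measurable_simplexNormalize hE)]
  congr 1
  ext v
  simp only [truncatedCone, Set.mem_inter_iff, Set.mem_preimage, Set.mem_ofPred_eq]
  tauto

instance : IsFiniteMeasure (lebesgue d) := by
  have hsub : {v : Fin (d + 1) → ℝ | (∀ k, 0 ≤ v k) ∧ ∑ k, v k ≤ 1} ⊆ Set.Icc 0 1 := by
    refine fun v hv => ⟨fun k => hv.1 k, fun k => ?_⟩
    exact (Finset.single_le_sum (fun k _ => hv.1 k) (Finset.mem_univ k)).trans hv.2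
  have : IsFiniteMeasure (volume.restrict
      {v : Fin (d + 1) → ℝ | (∀ k, 0 ≤ v k) ∧ ∑ k, v k ≤ 1}) :=
    ⟨by
      rw [Measure.restrict_apply_univ]
      exact (measure_mono hsub).trans_lt (isCompact_Icc.measure_lt_top)⟩
  unfold lebesgue
  infer_instance

theorem volume_truncatedCone (E : Set (Fin (d + 1) → ℝ)) {t : ℝ} (ht : 0 < t) :
    volume (truncatedCone E t) = ENNReal.ofReal (t ^ (d + 1)) * volume (truncatedCone E 1) := by
  have : truncatedCone E t = t • truncatedCone E 1 := by
    ext v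
    rw [Set.mem_smul_set_iff_inv_smul_mem₀ ht.ne']
    simp only [truncatedCone, Set.mem_ofPred_eq, simplexNormalize_smul (inv_pos.2 ht),
      Pi.smul_apply, smul_eq_mul, ← Finset.mul_sum, inv_mul_le_iff₀ ht, mul_one]
    refine and_congr_left fun _ => forall_congr' fun k => ?_
    exact (mul_nonneg_iff_of_pos_left (inv_pos.2 ht)).symm
  rw [this, Measure.addHaar_smul_of_nonneg _ ht.le]
  simp

variable {M : Matrix (Fin (d + 1)) (Fin (d + 1)) ℤ}

/-- The coordinate sum of M x is a linear form in x with nonnegative coefficients. This ratio of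
norms is the only source of distortion, since M preserves volume. -/
theorem sum_mulVec_bounds (hM : ∀ k l, 0 ≤ M k l) {κ : ℝ} {x : Fin (d + 1) → ℝ}
    (hκ : ∀ k, κ ≤ x k) (h1 : ∀ k, x k ≤ 1) :
    κ * ∑ k, ∑ l, (M k l : ℝ) ≤ ∑ k, (M.map (Int.cast : ℤ → ℝ) *ᵥ x) k ∧
      ∑ k, (M.map (Int.cast : ℤ → ℝ) *ᵥ x) k ≤ ∑ k, ∑ l, (M k l : ℝ) := by
  have hM' : ∀ k l, (0 : ℝ) ≤ M k l := fun k l => by exact_mod_cast hM k l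
  simp only [Matrix.mulVec, dotProduct, Matrix.map_apply, Finset.mul_sum]
  constructor
  · refine Finset.sum_le_sum fun k _ => Finset.sum_le_sum fun l _ => ?_
    rw [mul_comm]
    exact mul_le_mul_of_nonneg_left (hκ l) (hM' k l)
  · refine Finset.sum_le_sum fun k _ => Finset.sum_le_sum fun l _ => ?_
    exact mul_le_of_le_one_right (hM' k l) (h1 l)

theorem mulVec_nonneg (hM : ∀ k l, 0 ≤ M k l) {v : Fin (d + 1) → ℝ} (hv : ∀ k, 0 ≤ v k)
    (k : Fin (d + 1)) : 0 ≤ (M.map (Int.cast : ℤ → ℝ) *ᵥ v) k := by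
  rw [Matrix.mulVec, dotProduct]
  exact Finset.sum_nonneg fun l _ => mul_nonneg (Int.cast_nonneg (hM k l)) (hv l)

theorem sum_entries_pos (hM : ∀ k l, 0 ≤ M k l) (hdet : IsUnit M.det) :
    (0 : ℝ) < ∑ k, ∑ l, (M k l : ℝ) := by
  have hM' : ∀ k l, (0 : ℝ) ≤ M k l := fun k l => by exact_mod_cast hM k l
  refine lt_of_le_of_ne (Finset.sum_nonneg fun k _ => Finset.sum_nonneg fun l _ => hM' k l) ?_
  intro h
  have h0 : M = 0 := by
    ext k l
    have h1 := (Finset.sum_eq_zero_iff_of_nonneg fun k _ =>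
      Finset.sum_nonneg fun l _ => hM' k l).1 h.symm k (Finset.mem_univ k)
    have h2 := (Finset.sum_eq_zero_iff_of_nonneg fun l _ => hM' k l).1 h1 l (Finset.mem_univ l)
    exact_mod_cast h2
  rw [h0, Matrix.det_zero] at hdet
  exact not_isUnit_zero hdet

/-- Passing to cones linearizes the projective map; only the height of the cut changes, becoming a
condition on the coordinate sum of M v. -/
theorem truncatedCone_image (hM : ∀ k l, 0 ≤ M k l) (hdet : IsUnit M.det) {κ : ℝ} (hκ : 0 < κ)
    {E : Set (Fin (d + 1) → ℝ)} (hE : E ⊆ {x ∈ stdSimplex ℝ (Fin (d + 1)) | ∀ k, κ ≤ x k}) :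
    truncatedCone (projAct M '' E) 1 = Matrix.toLin' (M.map (Int.cast : ℤ → ℝ)) ''
      {v | (∀ k, 0 ≤ v k) ∧ ∑ k, (M.map (Int.cast : ℤ → ℝ) *ᵥ v) k ≤ 1 ∧
        simplexNormalize v ∈ E} := by
  ext v
  constructor
  · rintro ⟨hv, hv1, x, hx, hxv⟩
    have hx0 := (hE hx).1.1
    have hMx := mulVec_nonneg hM hx0
    have hq : 0 < ∑ k, (M.map (Int.cast : ℤ → ℝ) *ᵥ x) k :=
      (mul_pos hκ (sum_entries_pos hM hdet)).trans_le
        (sum_mulVec_bounds hM (hE hx).2 (fun k => (mem_Icc_of_mem_stdSimplex (hE hx).1 k).2)).1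
    rw [projAct, simplexNormalize_of_nonneg hMx] at hxv
    set q := ∑ k, (M.map (Int.cast : ℤ → ℝ) *ᵥ x) k with hqdef
    have hvx := sum_smul_simplexNormalize hv
    rw [← hxv, smul_smul, ← Matrix.mulVec_smul] at hvx
    -- The apex is excluded: `simplexNormalize` sends 0 to 0, whereas the normalized vector M x is
    -- nonzero.
    have hc : 0 < ∑ k, v k := by
      refine lt_of_le_of_ne (Finset.sum_nonneg fun k _ => hv k) fun h0 => ?_
      rw [← h0, zero_mul, zero_smul, Matrix.mulVec_zero] at hvx
      rw [← hvx, simplexNormalize_zero] at hxv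
      rcases smul_eq_zero.1 hxv with h | h
      · exact (inv_pos.2 hq).ne' h
      · rw [hqdef, h] at hq; simp at hq
    have hcq : 0 < (∑ k, v k) * q⁻¹ := mul_pos hc (inv_pos.2 hq)
    refine ⟨((∑ k, v k) * q⁻¹) • x, ⟨fun k => mul_nonneg hcq.le (hx0 k), ?_, ?_⟩, ?_⟩
    · rw [hvx]; exact hv1
    · rw [simplexNormalize_smul hcq, simplexNormalize_of_mem (hE hx).1]; exact hx
    · rw [Matrix.toLin'_apply, hvx]
  · rintro ⟨t, ⟨ht, ht1, htE⟩, rfl⟩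
    rw [Matrix.toLin'_apply]
    exact ⟨mulVec_nonneg hM ht, ht1, simplexNormalize t, htE, projAct_simplexNormalize M t⟩

/-- The image under a nonnegative unimodular projective map of sets that stay away from the boundary
of the simplex has, up to a uniform factor, constant Jacobian. -/
theorem exists_lebesgue_image_projAct_bounds (hM : ∀ k l, 0 ≤ M k l) (hdet : IsUnit M.det) {κ : ℝ}
    (hκ : 0 < κ) : ∃ c : ℝ≥0∞, c ≠ 0 ∧ c ≠ ∞ ∧ ∀ E : Set (Fin (d + 1) → ℝ), MeasurableSet E →
      MeasurableSet (projAct M '' E) →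
      E ⊆ {x ∈ stdSimplex ℝ (Fin (d + 1)) | ∀ k, κ ≤ x k} →
      c * lebesgue d E ≤ lebesgue d (projAct M '' E) ∧
      lebesgue d (projAct M '' E) ≤ ENNReal.ofReal (κ⁻¹ ^ (d + 1)) * c * lebesgue d E := by
  set s := ∑ k, ∑ l, (M k l : ℝ) with hs
  have hspos : 0 < s := sum_entries_pos hM hdet
  -- With s the sum of the entries of M, the coordinate sum of M v lies between κs and s times that
  -- of v. The region mapped onto the image cone therefore lies between the cones over E of heights
  -- 1/s and 1/(κs).
  refine ⟨ENNReal.ofReal (s⁻¹ ^ (d + 1)), by simpa using by positivity, ENNReal.ofReal_ne_top,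
    fun E hEm hEm' hE => ?_⟩
  have hdet' : |LinearMap.det (Matrix.toLin' (M.map (Int.cast : ℤ → ℝ)))| = 1 := by
    rw [LinearMap.det_toLin']
    have : (M.map (Int.cast : ℤ → ℝ)).det = (M.det : ℝ) := (Int.cast_det M).symm
    rw [this]
    rcases Int.isUnit_iff.1 hdet with h | h <;> simp [h]
  rw [lebesgue_apply hEm, lebesgue_apply hEm', truncatedCone_image hM hdet hκ hE,
    Measure.addHaar_image_linearMap, hdet', ENNReal.ofReal_one, one_mul,
    ← ENNReal.ofReal_mul (by positivity), ← mul_pow, ← volume_truncatedCone E (inv_pos.2 hspos),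
    ← volume_truncatedCone E (mul_pos (inv_pos.2 hκ) (inv_pos.2 hspos))]
  have hb : ∀ v : Fin (d + 1) → ℝ, (∀ k, 0 ≤ v k) → simplexNormalize v ∈ E →
      (∑ k, v k) * (κ * s) ≤ ∑ k, (M.map (Int.cast : ℤ → ℝ) *ᵥ v) k ∧
      ∑ k, (M.map (Int.cast : ℤ → ℝ) *ᵥ v) k ≤ (∑ k, v k) * s := by
    intro v hv hvE
    have hx := hE hvE
    have hbd := sum_mulVec_bounds hM hx.2 (fun k => (mem_Icc_of_mem_stdSimplex hx.1 k).2)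
    have hc : 0 ≤ ∑ k, v k := Finset.sum_nonneg fun k _ => hv k
    have hsum : ∑ k, (M.map (Int.cast : ℤ → ℝ) *ᵥ v) k =
        (∑ k, v k) * ∑ k, (M.map (Int.cast : ℤ → ℝ) *ᵥ simplexNormalize v) k := by
      conv_lhs => rw [← sum_smul_simplexNormalize hv, Matrix.mulVec_smul]
      simp only [Pi.smul_apply, smul_eq_mul, Finset.mul_sum]
    rw [hsum]
    exact ⟨mul_le_mul_of_nonneg_left hbd.1 hc, mul_le_mul_of_nonneg_left hbd.2 hc⟩
  constructor
  · refine measure_mono fun v hv => ⟨hv.1, (hb v hv.1 hv.2.2).2.trans ?_, hv.2.2⟩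
    calc (∑ k, v k) * s ≤ s⁻¹ * s := mul_le_mul_of_nonneg_right hv.2.1 hspos.le
      _ = 1 := inv_mul_cancel₀ hspos.ne'
  · refine measure_mono fun v hv => ⟨hv.1, ?_, hv.2.2⟩
    have := (hb v hv.1 hv.2.2).1.trans hv.2.1
    rw [← mul_inv, ← one_div, le_div_iff₀ (mul_pos hκ hspos)]
    exact this

end Projective

/-- The interior is relative to the affine span, so it need not be open; it is a closed simplex
minus its finitely many closed facets. -/
theorem measurableSet_interior {n : ℕ} {V : Type*} [NormedAddCommGroup V] [NormedSpace ℝ V]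
    [MeasurableSpace V] [BorelSpace V] (s : Affine.Simplex ℝ V n) : MeasurableSet s.interior := by
  rcases n with _ | n
  · rw [Affine.Simplex.interior_eq_empty]; exact MeasurableSet.empty
  · have h : s.interior = s.closedInterior \ (s.closedInterior \ s.interior) := by
      rw [Set.sdiff_sdiff_cancel_left s.interior_subset_closedInterior]
    rw [h, s.closedInterior_sdiff_interior]
    exact s.isClosed_closedInterior.measurableSet.diff
      (MeasurableSet.iUnion fun i => (s.faceOpposite i).isClosed_closedInterior.measurableSet)

/-! ### Cylinders of maps with full branches -/

section FullBranch

variable {α L : Type*} {X : Set α} {Q : α → α} {P : L → Set α}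

theorem wordCylinder_subset (w : List L) : wordCylinder X Q P w ⊆ X := fun _ hx => hx.1

theorem mem_wordCylinder_cons (hPX : ∀ l, P l ⊆ X) (hQX : ∀ l, ∀ x ∈ P l, Q x ∈ X) {l : L}
    {w : List L} {x : α} :
    x ∈ wordCylinder X Q P (l :: w) ↔ x ∈ P l ∧ Q x ∈ wordCylinder X Q P w := by
  constructor
  · rintro ⟨_, h⟩
    have h0 : x ∈ P l := h 0 (by simp)
    refine ⟨h0, hQX l x h0, fun k hk => ?_⟩
    exact h (k + 1) (by simpa using hk)
  · rintro ⟨h0, _, h⟩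
    refine ⟨hPX l h0, fun k hk => ?_⟩
    rcases k with _ | k
    · simpa using h0
    · simpa using h k (by simpa using hk)

/-- If every nonempty piece is mapped onto `X`, with inverse branches `φ`, then a cylinder is the
image of a shorter one under the composed inverse branches. -/
theorem wordCylinder_append_eq_image (hPX : ∀ l, P l ⊆ X) (hQX : ∀ l, ∀ x ∈ P l, Q x ∈ X)
    {φ : L → α → α} {Φ : List L → α → α} (hφ : ∀ l, (P l).Nonempty → ∀ y ∈ X, φ l y ∈ P l)
    (hright : ∀ l, (P l).Nonempty → ∀ y ∈ X, Q (φ l y) = y)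
    (hleft : ∀ l, ∀ x ∈ P l, φ l (Q x) = x) (hnil : ∀ y ∈ X, Φ [] y = y)
    (hcons : ∀ l w y, Φ (l :: w) y = φ l (Φ w y)) (w v : List L)
    (hw : (wordCylinder X Q P w).Nonempty) :
    wordCylinder X Q P (w ++ v) = Φ w '' wordCylinder X Q P v := by
  induction w with
  | nil =>
    ext x
    refine ⟨fun hx => ⟨x, hx, hnil x hx.1⟩, ?_⟩
    rintro ⟨y, hy, rfl⟩
    rw [hnil y hy.1]
    exact hy
  | cons l w ih =>
    obtain ⟨x₀, hx₀⟩ := hw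
    rw [mem_wordCylinder_cons hPX hQX] at hx₀
    have ih' := ih ⟨_, hx₀.2⟩
    have hne : (P l).Nonempty := ⟨_, hx₀.1⟩
    ext x
    rw [List.cons_append, mem_wordCylinder_cons hPX hQX, ih']
    constructor
    · rintro ⟨hx, y, hy, hyx⟩
      exact ⟨y, hy, by rw [hcons, hyx, hleft l x hx]⟩
    · rintro ⟨y, hy, rfl⟩
      have hz : Φ w y ∈ wordCylinder X Q P (w ++ v) := by rw [ih']; exact ⟨y, hy, rfl⟩
      rw [hcons]
      exact ⟨hφ l hne _ hz.1, y, hy, (hright l hne _ hz.1).symm⟩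

end FullBranch

/-! ### Inverse branches along paths of the Rauzy diagram -/

namespace SimplexSplitting

variable {d : ℕ} {ι : Type*} (T : SimplexSplitting d ι)

theorem piece_subset_stdSimplex (i : ι) : T.piece i ⊆ stdSimplex ℝ (Fin (d + 1)) := by
  rintro x ⟨w, hw1, hw, rfl⟩
  rw [Finset.affineCombination_eq_linear_combination _ _ _ hw1]
  exact (convex_stdSimplex ℝ _).sum_mem (fun k _ => (hw k).1.le) hw1
    fun k _ => T.vertex_mem i k

theorem eq_of_mem_piece {i j : ι} {x : Fin (d + 1) → ℝ} (hi : x ∈ T.piece i)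
    (hj : x ∈ T.piece j) : i = j := by
  by_contra h
  exact Set.disjoint_left.1 (T.disjoint i j h) hi hj

theorem f_of_mem {i : ι} {x : Fin (d + 1) → ℝ} (hx : x ∈ T.piece i) :
    T.f x = projAct (T.A i : Matrix (Fin (d + 1)) (Fin (d + 1)) ℤ) x := by
  have h : ∃ i, x ∈ T.piece i := ⟨i, hx⟩
  rw [f, dif_pos h, T.eq_of_mem_piece h.choose_spec hx]

theorem f_of_notMem {x : Fin (d + 1) → ℝ} (hx : ∀ i, x ∉ T.piece i) : T.f x = x :=
  dif_neg (by simpa using hx)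

theorem f_mem_stdSimplex {i : ι} {x : Fin (d + 1) → ℝ} (hx : x ∈ T.piece i) :
    T.f x ∈ stdSimplex ℝ (Fin (d + 1)) := by
  rw [T.f_of_mem hx]
  exact T.mapsTo i x hx

/-- The inverse branch of `f` on `Δ_i`. -/
theorem projAct_inv_f {i : ι} {x : Fin (d + 1) → ℝ} (hx : x ∈ T.piece i) :
    projAct ((T.A i)⁻¹ : GL (Fin (d + 1)) ℤ).val (T.f x) = x := by
  rw [T.f_of_mem hx, ← projAct_mul, Units.inv_mul, projAct_one (T.piece_subset_stdSimplex i hx)]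

theorem inverse_branch_of_arrow {i j : ι} (h : T.Arrow i j) {y : Fin (d + 1) → ℝ}
    (hy : y ∈ T.piece j) : projAct ((T.A i)⁻¹ : GL (Fin (d + 1)) ℤ).val y ∈ T.piece i ∧
      T.f (projAct ((T.A i)⁻¹ : GL (Fin (d + 1)) ℤ).val y) = y := by
  obtain ⟨x₀, hx₀, hfx₀⟩ := h
  obtain ⟨x, hx, rfl⟩ := T.markov i j ⟨_, ⟨x₀, hx₀, (T.f_of_mem hx₀).symm⟩, hfx₀⟩ hy
  rw [← T.f_of_mem hx, T.projAct_inv_f hx]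
  exact ⟨hx, rfl⟩

@[simp]
theorem pathMatrix_nil : T.pathMatrix [] = 1 := by simp [pathMatrix]

theorem pathMatrix_append (u v : List ι) :
    T.pathMatrix (u ++ v) = T.pathMatrix u * T.pathMatrix v := by
  simp [pathMatrix]

theorem pathMatrix_cons (i : ι) (u : List ι) :
    T.pathMatrix (i :: u) = ((T.A i)⁻¹ : GL (Fin (d + 1)) ℤ).val * T.pathMatrix u := by
  simp [pathMatrix]

theorem pathMatrix_nonneg (u : List ι) (k l : Fin (d + 1)) : 0 ≤ T.pathMatrix u k l := by
  induction u generalizing k l with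
  | nil =>
    rw [pathMatrix_nil, Matrix.one_apply]
    split_ifs <;> simp
  | cons i u ih =>
    rw [pathMatrix_cons, Matrix.mul_apply]
    exact Finset.sum_nonneg fun m _ => mul_nonneg (T.quotient_nonneg i k m) (ih m l)

theorem isUnit_det_pathMatrix (u : List ι) : IsUnit (T.pathMatrix u).det :=
  (Matrix.isUnit_iff_isUnit_det _).1 (Units.isUnit _)

theorem mem_subsimplex_cons {i : ι} {u : List ι} {x : Fin (d + 1) → ℝ} :
    x ∈ T.subsimplex (i :: u) ↔ x ∈ T.piece i ∧ T.f x ∈ T.subsimplex u :=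
  mem_wordCylinder_cons T.piece_subset_stdSimplex fun _ _ => T.f_mem_stdSimplex

theorem mem_subsimplex_append {u v : List ι} {x : Fin (d + 1) → ℝ} :
    x ∈ T.subsimplex (u ++ v) ↔ x ∈ T.subsimplex u ∧ T.f^[u.length] x ∈ T.subsimplex v := by
  induction u generalizing x with
  | nil =>
    refine ⟨fun h => ⟨?_, h⟩, fun h => h.2⟩
    rw [subsimplex, wordCylinder_nil]
    exact h.1
  | cons i u ih =>
    rw [List.cons_append, mem_subsimplex_cons, mem_subsimplex_cons, ih, List.length_cons,
      Function.iterate_succ_apply, and_assoc]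

theorem iterate_mem_stdSimplex {u : List ι} {x : Fin (d + 1) → ℝ} (hx : x ∈ T.subsimplex u) :
    T.f^[u.length] x ∈ stdSimplex ℝ (Fin (d + 1)) := by
  rw [← List.append_nil u, mem_subsimplex_append] at hx
  exact hx.2.1

theorem projAct_pathMatrix_iterate {u : List ι} {x : Fin (d + 1) → ℝ} (hx : x ∈ T.subsimplex u) :
    projAct (T.pathMatrix u) (T.f^[u.length] x) = x := by
  induction u generalizing x with
  | nil => rw [pathMatrix_nil]; exact projAct_one hx.1
  | cons i u ih =>
    rw [mem_subsimplex_cons] at hx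
    rw [List.length_cons, Function.iterate_succ_apply, pathMatrix_cons, projAct_mul, ih hx.2,
      T.projAct_inv_f hx.1]

/-- A point of the cylinder supplies the arrows along u and into v, and the Markov property inverts
f along each of them. The word v must be nonempty so that the last letter of u also has an arrow
leaving it. -/
theorem inverse_branch_of_nonempty {u v : List ι} (hv : v ≠ [])
    (hne : (T.subsimplex (u ++ v)).Nonempty) {y : Fin (d + 1) → ℝ} (hy : y ∈ T.subsimplex v) :
    projAct (T.pathMatrix u) y ∈ T.subsimplex (u ++ v) ∧
      T.f^[u.length] (projAct (T.pathMatrix u) y) = y := by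
  induction u with
  | nil => rw [pathMatrix_nil, projAct_one hy.1]; exact ⟨hy, rfl⟩
  | cons i u ih =>
    obtain ⟨x₀, hx₀⟩ := hne
    rw [List.cons_append, mem_subsimplex_cons] at hx₀
    obtain ⟨hz, hzy⟩ := ih ⟨_, hx₀.2⟩
    obtain ⟨j, r, hjr⟩ := List.exists_cons_of_ne_nil
      (show u ++ v ≠ [] by simp [hv])
    have hx₁ := hx₀.2
    have hz' := hz
    rw [hjr, mem_subsimplex_cons] at hx₁ hz'
    have hb := T.inverse_branch_of_arrow ⟨x₀, hx₀.1, hx₁.1⟩ hz'.1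
    rw [pathMatrix_cons, projAct_mul, List.cons_append, mem_subsimplex_cons, List.length_cons,
      Function.iterate_succ_apply, hb.2]
    exact ⟨⟨hb.1, hz⟩, hzy⟩

/-- As the pieces are disjoint, a visit to Δ_γ at time k is read off from the letters k, …, k + |γ|
- 1 of the itinerary. -/
theorem mem_subsimplex_of_common_itinerary {γ z : List ι} {x x₀ : Fin (d + 1) → ℝ}
    (hx : x ∈ T.subsimplex z) (hx₀ : x₀ ∈ T.subsimplex z) (hγ : γ ≠ []) {k : ℕ}
    (hk : k + γ.length ≤ z.length) (h : T.f^[k] x₀ ∈ T.subsimplex γ) :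
    T.f^[k] x ∈ T.subsimplex γ := by
  have hlen := List.length_pos_iff.2 hγ
  refine ⟨T.piece_subset_stdSimplex _ (hx.2 k (by omega)), fun j hj => ?_⟩
  have h₁ := h.2 j hj
  rw [← Function.iterate_add_apply] at h₁ ⊢
  rw [T.eq_of_mem_piece h₁ (hx₀.2 (j + k) (by omega))]
  exact hx.2 (j + k) (by omega)

/-- A point of Δ_γ is the normalization of M y with y in the simplex and M the path matrix. Positive
integer entries are at least 1, so each coordinate of M y is at least 1, while their sum is at most
the sum s of the entries of M. Thus κ = 1/s works. -/
theorem exists_forall_le_of_mem_subsimplex {γ : List ι} (hγ : ∀ k l, 0 < T.pathMatrix γ k l) :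
    ∃ κ : ℝ, 0 < κ ∧ T.subsimplex γ ⊆ {x ∈ stdSimplex ℝ (Fin (d + 1)) | ∀ k, κ ≤ x k} := by
  set s := ∑ k, ∑ l, (T.pathMatrix γ k l : ℝ) with hs
  have hspos : 0 < s := sum_entries_pos (T.pathMatrix_nonneg γ) (T.isUnit_det_pathMatrix γ)
  refine ⟨s⁻¹, inv_pos.2 hspos, fun x hx => ⟨hx.1, fun k => ?_⟩⟩
  have hy := T.iterate_mem_stdSimplex hx
  rw [← T.projAct_pathMatrix_iterate hx]
  set y := T.f^[γ.length] x
  have hMy := mulVec_nonneg (T.pathMatrix_nonneg γ) hy.1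
  rw [projAct, simplexNormalize_of_nonneg hMy, Pi.smul_apply, smul_eq_mul]
  have hone : ∀ k, 1 ≤ ((T.pathMatrix γ).map (Int.cast : ℤ → ℝ) *ᵥ y) k := by
    intro k
    rw [← hy.2, Matrix.mulVec, dotProduct]
    refine Finset.sum_le_sum fun l _ => le_mul_of_one_le_left (hy.1 l) ?_
    rw [Matrix.map_apply]
    exact_mod_cast hγ k l
  have hle := (sum_mulVec_bounds (T.pathMatrix_nonneg γ) hy.1
    (fun k => (mem_Icc_of_mem_stdSimplex hy k).2)).2
  have hpos : 0 < ∑ k, ((T.pathMatrix γ).map (Int.cast : ℤ → ℝ) *ᵥ y) k :=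
    Finset.sum_pos (fun k _ => zero_lt_one.trans_le (hone k)) Finset.univ_nonempty
  calc s⁻¹ ≤ (∑ k, ((T.pathMatrix γ).map (Int.cast : ℤ → ℝ) *ᵥ y) k)⁻¹ := by gcongr
    _ ≤ _ := le_mul_of_one_le_right (inv_pos.2 hpos).le (hone k)

theorem measurable_f [Countable ι] : Measurable T.f := by
  intro E hE
  have : T.f ⁻¹' E = (⋃ i, T.piece i ∩
      projAct (T.A i : Matrix (Fin (d + 1)) (Fin (d + 1)) ℤ) ⁻¹' E) ∪ ((⋃ i, T.piece i)ᶜ ∩ E) := by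
    ext x
    by_cases h : ∃ i, x ∈ T.piece i
    · obtain ⟨i, hi⟩ := h
      simp only [Set.mem_preimage, T.f_of_mem hi, Set.mem_union, Set.mem_iUnion, Set.mem_inter_iff,
        Set.mem_compl_iff]
      constructor
      · exact fun hx => Or.inl ⟨i, hi, hx⟩
      · rintro (⟨j, hj, hx⟩ | ⟨hx, -⟩)
        · rwa [T.eq_of_mem_piece hi hj]
        · exact absurd ⟨i, hi⟩ hx
    · push Not at h
      simp [T.f_of_notMem h, h]
  rw [this]
  exact (MeasurableSet.iUnion fun i => (measurableSet_interior _).inter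
    (measurable_projAct _ hE)).union
      ((MeasurableSet.iUnion fun i => measurableSet_interior _).compl.inter hE)

theorem measurableSet_subsimplex [Countable ι] (γ : List ι) : MeasurableSet (T.subsimplex γ) := by
  have : T.subsimplex γ = stdSimplex ℝ (Fin (d + 1)) ∩
      ⋂ (k : ℕ), ⋂ (hk : k < γ.length), T.f^[k] ⁻¹' T.piece γ[k] := by
    ext x; simp [subsimplex, wordCylinder]
  rw [this]
  exact (isClosed_stdSimplex ℝ (Fin (d + 1))).measurableSet.inter (MeasurableSet.iInter fun k =>
    MeasurableSet.iInter fun _ => T.measurable_f.iterate k (measurableSet_interior _))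

end SimplexSplitting

/-! ### The special acceleration as a full-branch map -/

namespace SimplexSplitting

variable {d : ℕ} {ι : Type*} (T : SimplexSplitting d ι)

theorem mem_accelerationPiece {γ u : List ι} {x : Fin (d + 1) → ℝ} :
    x ∈ T.accelerationPiece γ u ↔ x ∈ T.subsimplex γ ∧ x ∈ T.subsimplex u ∧ 0 < u.length ∧
      T.f^[u.length] x ∈ T.subsimplex γ ∧
      ∀ k, 0 < k → k < u.length → T.f^[k] x ∉ T.subsimplex γ := by
  constructor
  · rintro ⟨h₁, h₂, h₃, h₄⟩
    have hmem : u.length ∈ T.returnTimes γ x := h₃ ▸ Nat.sInf_mem h₂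
    refine ⟨h₁, h₄, hmem.1, hmem.2, fun k hk0 hk hkγ => ?_⟩
    have : T.returnTime γ x ≤ k := Nat.sInf_le ⟨hk0, hkγ⟩
    omega
  · rintro ⟨h₁, h₂, h₃, h₄, h₅⟩
    have hne : (T.returnTimes γ x).Nonempty := ⟨u.length, h₃, h₄⟩
    refine ⟨h₁, hne, le_antisymm (Nat.sInf_le ⟨h₃, h₄⟩) ?_, h₂⟩
    by_contra hlt
    obtain ⟨h0, hγ⟩ := Nat.sInf_mem hne
    exact h₅ _ h0 (not_le.1 hlt) hγ

theorem acceleration_of_mem {γ u : List ι} {x : Fin (d + 1) → ℝ}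
    (hx : x ∈ T.accelerationPiece γ u) : T.acceleration γ x = T.f^[u.length] x := by
  rw [acceleration, hx.2.2.1]

theorem accelerationPiece_subset (γ u : List ι) : T.accelerationPiece γ u ⊆ T.subsimplex γ :=
  fun _ hx => hx.1

theorem acceleration_mem {γ u : List ι} {x : Fin (d + 1) → ℝ}
    (hx : x ∈ T.accelerationPiece γ u) : T.acceleration γ x ∈ T.subsimplex γ := by
  rw [T.acceleration_of_mem hx]
  exact (T.mem_accelerationPiece.1 hx).2.2.2.1

theorem projAct_pathMatrix_acceleration {γ u : List ι} {x : Fin (d + 1) → ℝ}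
    (hx : x ∈ T.accelerationPiece γ u) :
    projAct (T.pathMatrix u) (T.acceleration γ x) = x := by
  rw [T.acceleration_of_mem hx]
  exact T.projAct_pathMatrix_iterate hx.2.2.2

/-- The special acceleration maps each of its nonempty pieces onto `Δ_γ`. -/
theorem inverse_branch_acceleration {γ u : List ι} (hγ : γ ≠ [])
    (hne : (T.accelerationPiece γ u).Nonempty) {y : Fin (d + 1) → ℝ} (hy : y ∈ T.subsimplex γ) :
    projAct (T.pathMatrix u) y ∈ T.accelerationPiece γ u ∧
      T.acceleration γ (projAct (T.pathMatrix u) y) = y := by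
  obtain ⟨x₀, hx₀⟩ := hne
  obtain ⟨h₁, h₂, h₃, h₄, h₅⟩ := T.mem_accelerationPiece.1 hx₀
  -- The itinerary u followed by γ determines all visits to Δ_γ up to time |u|. Hence the new point,
  -- which shares it with x₀, lies in Δ_γ and has the same first return time.
  have hx₀' : x₀ ∈ T.subsimplex (u ++ γ) := T.mem_subsimplex_append.2 ⟨h₂, h₄⟩
  obtain ⟨hx, hxy⟩ := T.inverse_branch_of_nonempty hγ ⟨x₀, hx₀'⟩ hy
  have hmem : projAct (T.pathMatrix u) y ∈ T.accelerationPiece γ u := by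
    refine T.mem_accelerationPiece.2 ⟨?_, (T.mem_subsimplex_append.1 hx).1, h₃,
      (T.mem_subsimplex_append.1 hx).2, fun k hk0 hk hkγ => h₅ k hk0 hk ?_⟩
    · exact T.mem_subsimplex_of_common_itinerary (k := 0) hx hx₀' hγ (by simp) h₁
    · exact T.mem_subsimplex_of_common_itinerary hx₀' hx hγ
        (by rw [List.length_append]; omega) hkγ
  exact ⟨hmem, by rw [T.acceleration_of_mem hmem, hxy]⟩

theorem pairwise_disjoint_accelerationPiece (γ : List ι) :
    Pairwise (Function.onFun Disjoint (T.accelerationPiece γ)) := by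
  intro u v hne
  refine Set.disjoint_left.2 fun x hu hv => hne ?_
  have hlen : u.length = v.length := hu.2.2.1.symm.trans hv.2.2.1
  refine List.ext_getElem hlen fun k hku hkv => ?_
  exact T.eq_of_mem_piece (hu.2.2.2.2 k hku) (hv.2.2.2.2 k hkv)

/-- An orbit that left the pieces before returning would be fixed from then on, by the convention
for f, and could not come back to Δ_γ, which lies in the piece of the first letter of γ. -/
theorem exists_mem_accelerationPiece {γ : List ι} (hγ : γ ≠ []) {x : Fin (d + 1) → ℝ}
    (hx : x ∈ T.subsimplex γ) (hr : (T.returnTimes γ x).Nonempty) :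
    ∃ u, x ∈ T.accelerationPiece γ u := by
  set r := T.returnTime γ x
  have hmem : T.f^[r] x ∈ T.subsimplex γ := (Nat.sInf_mem hr).2
  have hpiece : ∀ k, ∃ i, k < r → T.f^[k] x ∈ T.piece i := by
    intro k
    have hlen := List.length_pos_iff.2 hγ
    by_cases hkr : k < r
    swap
    · exact ⟨γ[0], fun h => absurd h hkr⟩
    by_contra! hno
    have hfix : T.f (T.f^[k] x) = T.f^[k] x := T.f_of_notMem fun i => (hno i).2
    have hstuck : T.f^[r] x = T.f^[k] x := by
      rw [← Nat.sub_add_cancel hkr.le, Function.iterate_add_apply]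
      exact Function.iterate_fixed hfix _
    exact (hno γ[0]).2 (hstuck ▸ hmem.2 0 hlen)
  choose t ht using hpiece
  refine ⟨List.ofFn fun k : Fin r => t k, hx, hr, by simp [r], hx.1, fun k hk => ?_⟩
  have hk' : k < r := by simpa using hk
  simpa using ht k hk'

theorem measurableSet_accelerationPiece [Countable ι] (γ u : List ι) :
    MeasurableSet (T.accelerationPiece γ u) := by
  have hγm := T.measurableSet_subsimplex γ
  have : T.accelerationPiece γ u = T.subsimplex γ ∩ (T.subsimplex u ∩ ({_x | 0 < u.length} ∩
      (T.f^[u.length] ⁻¹' T.subsimplex γ ∩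
        ⋂ (k : ℕ), ⋂ (_ : 0 < k), ⋂ (_ : k < u.length), (T.f^[k] ⁻¹' T.subsimplex γ)ᶜ))) := by
    ext x
    rw [T.mem_accelerationPiece]
    simp
  rw [this]
  exact hγm.inter ((T.measurableSet_subsimplex u).inter ((MeasurableSet.const _).inter
    ((T.measurable_f.iterate _ hγm).inter (MeasurableSet.iInter fun k => MeasurableSet.iInter fun _ =>
      MeasurableSet.iInter fun _ => (T.measurable_f.iterate k hγm).compl))))

theorem measurableSet_accelerationCylinder [Countable ι] {γ : List ι} (w : List (List ι)) :
    MeasurableSet (wordCylinder (T.subsimplex γ) (T.acceleration γ) (T.accelerationPiece γ) w) := by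
  have hcons := fun u w x => mem_wordCylinder_cons (T.accelerationPiece_subset γ)
    (fun _ _ => T.acceleration_mem) (l := u) (w := w) (x := x)
  induction w with
  | nil => rw [wordCylinder_nil]; exact T.measurableSet_subsimplex γ
  | cons u w ih =>
    have : wordCylinder (T.subsimplex γ) (T.acceleration γ) (T.accelerationPiece γ) (u :: w) =
        T.accelerationPiece γ u ∩ T.f^[u.length] ⁻¹'
          wordCylinder (T.subsimplex γ) (T.acceleration γ) (T.accelerationPiece γ) w := by
      ext x
      rw [hcons, Set.mem_inter_iff, Set.mem_preimage]
      exact and_congr_right fun hx => by rw [T.acceleration_of_mem hx]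
    rw [this]
    exact (T.measurableSet_accelerationPiece γ u).inter (T.measurable_f.iterate _ ih)

theorem accelerationCylinder_append {γ : List ι} (hγ : γ ≠ []) (w v : List (List ι))
    (hw : (wordCylinder (T.subsimplex γ) (T.acceleration γ) (T.accelerationPiece γ) w).Nonempty) :
    wordCylinder (T.subsimplex γ) (T.acceleration γ) (T.accelerationPiece γ) (w ++ v) =
      projAct (T.pathMatrix w.flatten) ''
        wordCylinder (T.subsimplex γ) (T.acceleration γ) (T.accelerationPiece γ) v := by
  refine wordCylinder_append_eq_image (T.accelerationPiece_subset γ)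
    (fun _ _ => T.acceleration_mem) (φ := fun u => projAct (T.pathMatrix u))
    (Φ := fun w => projAct (T.pathMatrix w.flatten))
    (fun u hu y hy => (T.inverse_branch_acceleration hγ hu hy).1)
    (fun u hu y hy => (T.inverse_branch_acceleration hγ hu hy).2)
    (fun u x hx => T.projAct_pathMatrix_acceleration hx) (fun y hy => ?_) (fun u w y => ?_) w v hw
  · simpa using projAct_one hy.1
  · simp [pathMatrix_append, projAct_mul]

open scoped ENNReal in
/-- Lebesgue measure has the quasi-Bernoulli property for the special acceleration. -/
theorem exists_lebesgue_quasiBernoulli [Countable ι] {γ : List ι} (hγ : T.IsPositivePath γ)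
    (hpos : lebesgue d (T.subsimplex γ) ≠ 0) :
    ∃ K : ℝ≥0∞, K ≠ ∞ ∧ ∀ w : List (List ι),
      (wordCylinder (T.subsimplex γ) (T.acceleration γ) (T.accelerationPiece γ) w).Nonempty →
      lebesgue d (wordCylinder (T.subsimplex γ) (T.acceleration γ) (T.accelerationPiece γ) w) ≠ 0 ∧
      ∀ v : List (List ι),
      lebesgue d (wordCylinder (T.subsimplex γ) (T.acceleration γ) (T.accelerationPiece γ)
        (w ++ v)) ≤ K *
        (lebesgue d (wordCylinder (T.subsimplex γ) (T.acceleration γ) (T.accelerationPiece γ) w) *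
        lebesgue d (wordCylinder (T.subsimplex γ) (T.acceleration γ) (T.accelerationPiece γ) v)) ∧
      lebesgue d (wordCylinder (T.subsimplex γ) (T.acceleration γ) (T.accelerationPiece γ) w) *
        lebesgue d (wordCylinder (T.subsimplex γ) (T.acceleration γ) (T.accelerationPiece γ) v) ≤
      K * lebesgue d (wordCylinder (T.subsimplex γ) (T.acceleration γ) (T.accelerationPiece γ)
        (w ++ v)) := by
  obtain ⟨κ, hκ, hκγ⟩ := T.exists_forall_le_of_mem_subsimplex hγ.2
  set R : List (List ι) → Set (Fin (d + 1) → ℝ) :=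
    wordCylinder (T.subsimplex γ) (T.acceleration γ) (T.accelerationPiece γ) with hR
  set m := lebesgue d (T.subsimplex γ) with hm
  have hmtop : m ≠ ∞ := measure_ne_top _ _
  set b : ℝ≥0∞ := ENNReal.ofReal (κ⁻¹ ^ (d + 1)) with hb
  have hmeas : ∀ w, MeasurableSet (R w) := T.measurableSet_accelerationCylinder
  -- Here c is the Jacobian constant of the branch of w. The upper bound uses c m ≤ ρ[w] and gives
  -- b/m; the lower one uses ρ[w] ≤ b c m and gives b m. The sum serves for both.
  refine ⟨b * m⁻¹ + b * m, by finiteness, fun w hw => ?_⟩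
  have happ := fun v => T.accelerationCylinder_append hγ.1.1 w v hw
  obtain ⟨c, hc0, hctop, hc⟩ := exists_lebesgue_image_projAct_bounds
    (T.pathMatrix_nonneg w.flatten) (T.isUnit_det_pathMatrix w.flatten) hκ
  have hbd : ∀ v, c * lebesgue d (R v) ≤ lebesgue d (R (w ++ v)) ∧
      lebesgue d (R (w ++ v)) ≤ b * c * lebesgue d (R v) := by
    intro v
    have := hc (R v) (hmeas v) (by rw [← happ v]; exact hmeas _)
      ((wordCylinder_subset v).trans hκγ)
    rwa [← happ v] at this
  have hw' := hbd []
  rw [List.append_nil, show R [] = T.subsimplex γ from wordCylinder_nil] at hw'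
  refine ⟨fun h0 => ?_, fun v => ⟨?_, ?_⟩⟩
  · rw [h0] at hw'
    exact mul_ne_zero hc0 hpos (le_zero_iff.1 hw'.1)
  · calc lebesgue d (R (w ++ v)) ≤ b * c * lebesgue d (R v) := (hbd v).2
      _ = b * m⁻¹ * (c * m * lebesgue d (R v)) := by
          rw [show b * m⁻¹ * (c * m * lebesgue d (R v)) =
            b * c * lebesgue d (R v) * (m⁻¹ * m) by ring, ENNReal.inv_mul_cancel hpos hmtop, mul_one]
      _ ≤ b * m⁻¹ * (lebesgue d (R w) * lebesgue d (R v)) := by gcongr; exact hw'.1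
      _ ≤ _ := by gcongr; exact le_self_add
  · calc lebesgue d (R w) * lebesgue d (R v) ≤ b * c * m * lebesgue d (R v) := by
          gcongr; exact hw'.2
      _ = b * m * (c * lebesgue d (R v)) := by ring
      _ ≤ b * m * lebesgue d (R (w ++ v)) := by gcongr; exact (hbd v).1
      _ ≤ _ := by gcongr; exact le_add_self

end SimplexSplitting

end MCF

theorem mainTheorem4 {d : ℕ} {ι : Type*} [Countable ι] (T : MCF.SimplexSplitting d ι)
    (γ : List ι) (hγ : T.IsPositivePath γ)
    (μ : MeasureTheory.Measure (Fin (d + 1) → ℝ)) (hμ : T.IsACErgodicMeasure γ μ) :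
    MCF.BoundedDistortion (T.subsimplex γ) (T.acceleration γ) (T.accelerationPiece γ) μ := by
  have := hμ.isProbabilityMeasure
  have hγm := T.measurableSet_subsimplex γ
  have hX : ∀ᵐ x ∂(MCF.lebesgue d).restrict (T.subsimplex γ), x ∈ T.subsimplex γ :=
    ae_restrict_mem hγm
  -- A null Δ_γ would force μ = 0, contradicting that μ is a probability measure.
  have hpos : MCF.lebesgue d (T.subsimplex γ) ≠ 0 := by
    intro h0
    have hμ0 : μ = 0 := by
      have hac := hμ.absolutelyContinuous
      rw [Measure.restrict_eq_zero.2 h0] at hac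
      exact Measure.absolutelyContinuous_zero_iff.1 hac
    exact IsProbabilityMeasure.ne_zero μ hμ0
  obtain ⟨K, hK, hKw⟩ := T.exists_lebesgue_quasiBernoulli hγ hpos
  set R := MCF.wordCylinder (T.subsimplex γ) (T.acceleration γ) (T.accelerationPiece γ) with hR
  have hres : ∀ w, (MCF.lebesgue d).restrict (T.subsimplex γ) (R w) = MCF.lebesgue d (R w) :=
    fun w => Measure.restrict_eq_self _ (MCF.wordCylinder_subset w)
  refine MCF.boundedDistortion_of_quasiBernoulli hμ.absolutelyContinuous hX
    hμ.ergodic.toMeasurePreserving (T.measurableSet_accelerationPiece γ)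
    (T.pairwise_disjoint_accelerationPiece γ) ?_ hK (fun w v => ?_) (fun w v => ?_) fun w hw => ?_
  · filter_upwards [hμ.ae_return, hμ.absolutelyContinuous.ae_le hX] with x hr hx
    exact T.exists_mem_accelerationPiece hγ.1.1 hx hr
  · simp only [← hR, hres]
    -- The Lebesgue estimate is available only for nonempty [w]; otherwise [wv] ⊆ [w] is empty too.
    rcases (R w).eq_empty_or_nonempty with h | h
    · have : R (w ++ v) = ∅ := by
        refine Set.eq_empty_of_forall_notMem fun x hx => ?_
        have hxw : x ∈ R w := ⟨hx.1, fun k hk => by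
          have := hx.2 k (by rw [List.length_append]; omega)
          rwa [List.getElem_append_left hk] at this⟩
        rw [h] at hxw
        exact hxw
      simp [this]
    · exact ((hKw w h).2 v).1
  · simp only [← hR, hres]
    rcases (R w).eq_empty_or_nonempty with h | h
    · simp [h]
    · exact ((hKw w h).2 v).2
  · rw [← hR, hres]
    exact (hKw w hw).1
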